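/- Let $M$ be a three-dimensional smooth manifold without boundary with an almost paracontact metric structure $(\phi,\xi,\eta,g)$: smooth tensor fields, where $\phi$ is a $(1,1)$-tensor field, $\xi$ a vector field, $\eta$ a 1-form and $g$ a pseudo-Riemannian metric of signature $(2,1)$ (two plus signs, one minus sign), such that $$\phi^2=\mathrm{Id}-\eta\otimes\xi,\qquad \eta(\xi)=1,\qquad g(\phi X,\phi Y)=-g(X,Y)+\eta(X)\eta(Y).$$ Let $\nabla$ be the Levi-Civita connection of $g$, $\Phi(X,Y)=g(X,\phi Y)$, and $h=\tfrac12\mathcal L_\xi\phi$. Use the normalisations $$d\eta(X,Y)=\tfrac12\big(X\eta(Y)-Y\eta(X)-\eta([X,Y])\big),$$ $$d\Phi(X,Y,Z)=\tfrac13\big(X\Phi(Y,Z)+Y\Phi(Z,X)+Z\Phi(X,Y)-\Phi([X,Y],Z)-\Phi([Y,Z],X)-\Phi([Z,X],Y)\big),$$ $$(\eta\wedge\Phi)(X,Y,Z)=\tfrac13\big(\eta(X)\Phi(Y,Z)+\eta(Y)\Phi(Z,X)+\eta(Z)\Phi(X,Y)\big).$$ Then there is a smooth function $f$ on $M$ such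 that, for all (local) smooth vector fields $X,Y,Z$, $$g((\nabla_X\phi)Y,Z)=\big(f\,\Phi(Y,X)+d\eta(\phi Y,X)+g(hY,X)\big)\eta(Z)-\big(f\,\Phi(Z,X)+d\eta(\phi Z,X)+g(hZ,X)\big)\eta(Y),$$ $$d\Phi=2f\,\eta\wedge\Phi .$$ -/

import Mathlib

open Bundle Manifold VectorField Module
open scoped ContDiff Topology

noncomputable section

namespace Paracontact

variable {E : Type*} [NormedAddCommGroup E] [NormedSpace ℝ E]
  {H : Type*} [TopologicalSpace H] (I : ModelWithCorners ℝ E H)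
  (M : Type*) [TopologicalSpace M] [ChartedSpace H M]

/-! ### Vector fields and forms

Forms are evaluated on vector fields. The normalisation is the one with the factors `1/2` and
`1/3` (so that `dη = Φ` for a paracontact metric manifold with `[E₁, E₂] = 2ξ`, where
`φ E₁ = E₁`, `φ E₂ = -E₂` and `g(E₁, E₂) = 1`). -/

/-- `X u`: the derivative of the function `u` along the vector field `X`. -/
def dirDeriv {M : Type*} [TopologicalSpace M] [ChartedSpace H M]
    (X : Π p : M, TangentSpace I p) (u : M → ℝ) (p : M) : ℝ :=
  mvfderiv I u p (X p)

/-- `dα(X, Y) = 1/2 (X α(Y) - Y α(X) - α([X, Y]))` for a 1-form `α`. -/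
def dOne {M : Type*} [TopologicalSpace M] [ChartedSpace H M]
    (α : Π p : M, TangentSpace I p → ℝ) (X Y : Π p : M, TangentSpace I p) (p : M) : ℝ :=
  (1 / 2) * (dirDeriv I X (fun q => α q (Y q)) p - dirDeriv I Y (fun q => α q (X q)) p
    - α p (mlieBracket I X Y p))

/-- `dβ(X, Y, Z) = 1/3 (X β(Y, Z) + Y β(Z, X) + Z β(X, Y)
- β([X, Y], Z) - β([Y, Z], X) - β([Z, X], Y))` for a 2-form `β`. -/
def dTwo {M : Type*} [TopologicalSpace M] [ChartedSpace H M]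
    (β : Π p : M, TangentSpace I p → TangentSpace I p → ℝ)
    (X Y Z : Π p : M, TangentSpace I p) (p : M) : ℝ :=
  (1 / 3) * (dirDeriv I X (fun q => β q (Y q) (Z q)) p
    + dirDeriv I Y (fun q => β q (Z q) (X q)) p
    + dirDeriv I Z (fun q => β q (X q) (Y q)) p
    - β p (mlieBracket I X Y p) (Z p)
    - β p (mlieBracket I Y Z p) (X p)
    - β p (mlieBracket I Z X p) (Y p))

/-- `(α ∧ β)(X, Y, Z) = 1/3 (α(X) β(Y, Z) + α(Y) β(Z, X) + α(Z) β(X, Y))` for a 1-form `α` and a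
2-form `β`. -/
def wedgeOneTwo {M : Type*} [TopologicalSpace M] [ChartedSpace H M]
    (α : Π p : M, TangentSpace I p → ℝ)
    (β : Π p : M, TangentSpace I p → TangentSpace I p → ℝ)
    (X Y Z : Π p : M, TangentSpace I p) (p : M) : ℝ :=
  (1 / 3) * (α p (X p) * β p (Y p) (Z p) + α p (Y p) * β p (Z p) (X p)
    + α p (Z p) * β p (X p) (Y p))

/-- The Lie derivative `(L_V T)Y = [V, T Y] - T [V, Y]` of a field of endomorphisms `T`. -/
def lieDerivEnd {M : Type*} [TopologicalSpace M] [ChartedSpace H M]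
    (V : Π p : M, TangentSpace I p)
    (T : Π p : M, TangentSpace I p →L[ℝ] TangentSpace I p)
    (Y : Π p : M, TangentSpace I p) (p : M) : TangentSpace I p :=
  mlieBracket I V (fun q => T q (Y q)) p - T p (mlieBracket I V Y p)

/-! ### Pseudo-Riemannian metrics and the Levi-Civita connection -/

/-- A smooth pseudo-Riemannian metric of signature `(r, s)` (`r` plus signs, `s` minus signs). -/
structure PseudoMetric [IsManifold I ∞ M] (r s : ℕ) where
  toFun : Π p : M, TangentSpace I p →L[ℝ] TangentSpace I p →L[ℝ] ℝ
  symm : ∀ (p : M) (u v : TangentSpace I p), toFun p u v = toFun p v u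
  smooth : ContMDiff I (I.prod 𝓘(ℝ, E →L[ℝ] E →L[ℝ] ℝ)) ∞
    (fun p => TotalSpace.mk' (E →L[ℝ] E →L[ℝ] ℝ)
      (E := fun p : M => TangentSpace I p →L[ℝ] TangentSpace I p →L[ℝ] ℝ) p (toFun p))
  signature : ∀ p : M, ∃ b : Basis (Fin r ⊕ Fin s) ℝ (TangentSpace I p),
    (∀ i j, i ≠ j → toFun p (b i) (b j) = 0) ∧
    (∀ i, toFun p (b (Sum.inl i)) (b (Sum.inl i)) = 1) ∧
    (∀ j, toFun p (b (Sum.inr j)) (b (Sum.inr j)) = -1)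

namespace PseudoMetric

variable {I M} [IsManifold I ∞ M] {r s : ℕ} (g : PseudoMetric I M r s)

/-- `X g(Y, Z) + Y g(Z, X) - Z g(X, Y) + g([X, Y], Z) - g([Y, Z], X) + g([Z, X], Y)`. -/
def koszul (X Y Z : Π p : M, TangentSpace I p) (p : M) : ℝ :=
  dirDeriv I X (fun q => g.toFun q (Y q) (Z q)) p
    + dirDeriv I Y (fun q => g.toFun q (Z q) (X q)) p
    - dirDeriv I Z (fun q => g.toFun q (X q) (Y q)) p
    + g.toFun p (mlieBracket I X Y p) (Z p)
    - g.toFun p (mlieBracket I Y Z p) (X p)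
    + g.toFun p (mlieBracket I Z X p) (Y p)

theorem mdifferentiableAt_apply {X Y : Π p : M, TangentSpace I p} {p : M}
    (hX : MDiffAt (T% X) p) (hY : MDiffAt (T% Y) p) :
    MDiffAt (fun q => g.toFun q (X q) (Y q)) p := by
  have : MDifferentiableAt I (I.prod 𝓘(ℝ))
      (fun q : M => TotalSpace.mk' ℝ (E := Bundle.Trivial M ℝ) q (g.toFun q (X q) (Y q))) p := by
    apply MDifferentiableAt.clm_bundle_apply₂ (F₁ := E) (F₂ := E)
    · exact (g.smooth p).mdifferentiableAt (by simp)
    · exact hX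
    · exact hY
  simp only [mdifferentiableAt_totalSpace] at this
  exact this.2

theorem nondegenerate (p : M) (v : TangentSpace I p) (h : ∀ w, g.toFun p v w = 0) : v = 0 := by
  obtain ⟨b, h0, h1, h2⟩ := g.signature p
  have key : ∀ j, b.repr v j * g.toFun p (b j) (b j) = 0 := by
    intro j
    have e := h (b j)
    rw [← b.sum_repr v, map_sum, sum_apply,
      Finset.sum_eq_single j (fun i _ hij => by simp [h0 i j hij]) (by simp)] at e
    simpa using e
  have hz : b.repr v = 0 := by
    ext j
    rcases j with j | j
    · simpa [h1] using key (Sum.inl j)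
    · simpa [h2] using key (Sum.inr j)
  simpa using hz

theorem koszul_tensorialAt {X Y : Π p : M, TangentSpace I p} {p : M} [CompleteSpace E]
    (hX : MDiffAt (T% X) p) (hY : MDiffAt (T% Y) p) :
    TensorialAt I E (fun Z : Π p : M, TangentSpace I p => g.koszul X Y Z p) p where
  smul {f Z} hf hZ := by
    have e1 := mvfderiv_mul hf (g.mdifferentiableAt_apply hY hZ)
    have e2 := mvfderiv_mul hf (g.mdifferentiableAt_apply hZ hX)
    have r1 : (fun q => g.toFun q (Y q) ((f • Z) q)) = f * fun q => g.toFun q (Y q) (Z q) := by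
      ext q; simp
    have r2 : (fun q => g.toFun q ((f • Z) q) (X q)) = f * fun q => g.toFun q (Z q) (X q) := by
      ext q; simp
    simp only [koszul, dirDeriv, r1, r2, e1, e2, mlieBracket_smul_left hf hZ,
      mlieBracket_smul_right hf hZ]
    simp [g.symm p (Z p)]
    ring
  add {Z Z'} hZ hZ' := by
    have e1 := mvfderiv_add (g.mdifferentiableAt_apply hY hZ) (g.mdifferentiableAt_apply hY hZ')
    have e2 := mvfderiv_add (g.mdifferentiableAt_apply hZ hX) (g.mdifferentiableAt_apply hZ' hX)
    have r1 : (fun q => g.toFun q (Y q) ((Z + Z') q)) =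
        (fun q => g.toFun q (Y q) (Z q)) + fun q => g.toFun q (Y q) (Z' q) := by
      ext q; simp
    have r2 : (fun q => g.toFun q ((Z + Z') q) (X q)) =
        (fun q => g.toFun q (Z q) (X q)) + fun q => g.toFun q (Z' q) (X q) := by
      ext q; simp
    simp only [koszul, dirDeriv, r1, r2, e1, e2, mlieBracket_add_left hZ hZ',
      mlieBracket_add_right hZ hZ']
    simp
    ring

theorem exists_leviCivita [FiniteDimensional ℝ E] {X Y : Π p : M, TangentSpace I p} {p : M}
    (hX : MDiffAt (T% X) p) (hY : MDiffAt (T% Y) p) :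
    ∃! v : TangentSpace I p, ∀ Z : Π p : M, TangentSpace I p, MDiffAt (T% Z) p →
      2 * g.toFun p v (Z p) = g.koszul X Y Z p := by
  have : CompleteSpace E := FiniteDimensional.complete ℝ E
  have : FiniteDimensional ℝ (TangentSpace I p) := inferInstanceAs (FiniteDimensional ℝ E)
  have hK := g.koszul_tensorialAt hX hY
  let flat : TangentSpace I p →ₗ[ℝ] Module.Dual ℝ (TangentSpace I p) :=
    { toFun := fun v => (g.toFun p v : TangentSpace I p →ₗ[ℝ] ℝ)
      map_add' := fun u v => by ext w; simp
      map_smul' := fun c v => by ext w; simp }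
  have hinj : Function.Injective flat := by
    rw [injective_iff_map_eq_zero]
    intro v hv
    exact g.nondegenerate p v fun w => LinearMap.congr_fun hv w
  have hsurj : Function.Surjective flat :=
    (LinearMap.injective_iff_surjective_of_finrank_eq_finrank
      (Subspace.dual_finrank_eq (K := ℝ)).symm).1 hinj
  obtain ⟨v, hv⟩ := hsurj ((1 / 2 : ℝ) • (TensorialAt.mkHom _ p hK : TangentSpace I p →ₗ[ℝ] ℝ))
  have hv' : ∀ w, g.toFun p v w = (1 / 2 : ℝ) * TensorialAt.mkHom _ p hK w :=
    fun w => LinearMap.congr_fun hv w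
  refine ⟨v, fun Z hZ => ?_, fun u hu => ?_⟩
  · rw [hv', TensorialAt.mkHom_apply hK hZ]
    ring
  · rw [← sub_eq_zero]
    refine g.nondegenerate p _ fun w => ?_
    have hw := hu (FiberBundle.extend E w) (FiberBundle.mdifferentiableAt_extend ..)
    rw [← TensorialAt.mkHom_apply hK (FiberBundle.mdifferentiableAt_extend ..),
      FiberBundle.extend_apply_self] at hw
    rw [map_sub, sub_apply, hv']
    linarith

open Classical in
/-- `∇_X Y` for the Levi-Civita connection `∇` of `g`, given by the Koszul formula. -/
def leviCivita [FiniteDimensional ℝ E] (X Y : Π p : M, TangentSpace I p) (p : M) :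
    TangentSpace I p :=
  if h : MDiffAt (T% X) p ∧ MDiffAt (T% Y) p then (g.exists_leviCivita h.1 h.2).choose else 0

theorem two_mul_leviCivita [FiniteDimensional ℝ E] {X Y Z : Π p : M, TangentSpace I p} {p : M}
    (hX : MDiffAt (T% X) p) (hY : MDiffAt (T% Y) p) (hZ : MDiffAt (T% Z) p) :
    2 * g.toFun p (g.leviCivita X Y p) (Z p) = g.koszul X Y Z p := by
  have h : MDiffAt (T% X) p ∧ MDiffAt (T% Y) p := ⟨hX, hY⟩
  rw [leviCivita, dif_pos h]
  exact (g.exists_leviCivita hX hY).choose_spec.1 Z hZ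

end PseudoMetric

/-! ### Almost paracontact metric manifolds -/

/-- An almost paracontact metric structure `(φ, ξ, η, g)` on a `(2n+1)`-dimensional manifold. -/
structure AlmostParacontactMetric [IsManifold I ∞ M] (n : ℕ) where
  φ : Π p : M, TangentSpace I p →L[ℝ] TangentSpace I p
  ξ : Π p : M, TangentSpace I p
  η : Π p : M, TangentSpace I p →L[ℝ] ℝ
  g : PseudoMetric I M (n + 1) n
  smooth_φ : ContMDiff I (I.prod 𝓘(ℝ, E →L[ℝ] E)) ∞
    (fun p => TotalSpace.mk' (E →L[ℝ] E)
      (E := fun p : M => TangentSpace I p →L[ℝ] TangentSpace I p) p (φ p))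
  smooth_ξ : ContMDiff I (I.prod 𝓘(ℝ, E)) ∞
    (fun p => TotalSpace.mk' E (E := fun p : M => TangentSpace I p) p (ξ p))
  smooth_η : ContMDiff I (I.prod 𝓘(ℝ, E →L[ℝ] ℝ)) ∞
    (fun p => TotalSpace.mk' (E →L[ℝ] ℝ)
      (E := fun p : M => TangentSpace I p →L[ℝ] ℝ) p (η p))
  φ_sq : ∀ (p : M) (v : TangentSpace I p), φ p (φ p v) = v - η p v • ξ p
  η_ξ : ∀ p : M, η p (ξ p) = 1
  g_φ_φ : ∀ (p : M) (u v : TangentSpace I p),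
    g.toFun p (φ p u) (φ p v) = - g.toFun p u v + η p u * η p v

namespace AlmostParacontactMetric

variable {I M} [IsManifold I ∞ M] {n : ℕ} (S : AlmostParacontactMetric I M n)

/-- The fundamental form `Φ(u, v) = g(u, φ v)`. -/
def Φ (p : M) (u v : TangentSpace I p) : ℝ := S.g.toFun p u (S.φ p v)

/-- The exterior derivative `dη(X, Y)`. -/
def dη (X Y : Π p : M, TangentSpace I p) (p : M) : ℝ :=
  dOne I (fun q v => S.η q v) X Y p

/-- The exterior derivative `dΦ(X, Y, Z)`. -/
def dΦ (X Y Z : Π p : M, TangentSpace I p) (p : M) : ℝ :=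
  dTwo I S.Φ X Y Z p

/-- `(η ∧ Φ)(X, Y, Z)`. -/
def ηΦ (X Y Z : Π p : M, TangentSpace I p) (p : M) : ℝ :=
  wedgeOneTwo I (fun q v => S.η q v) S.Φ X Y Z p

/-- The vector field `φ Y`. -/
def φv (Y : Π p : M, TangentSpace I p) (p : M) : TangentSpace I p := S.φ p (Y p)

/-- `h Y`, where `h = 1/2 L_ξ φ`. -/
def h (Y : Π p : M, TangentSpace I p) (p : M) : TangentSpace I p :=
  (1 / 2 : ℝ) • lieDerivEnd I S.ξ S.φ Y p

/-- `(∇_X φ) Y = ∇_X (φ Y) - φ (∇_X Y)`, with `∇` the Levi-Civita connection of `g`. -/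
def nablaφ [FiniteDimensional ℝ E] (X Y : Π p : M, TangentSpace I p) (p : M) :
    TangentSpace I p :=
  S.g.leviCivita X (S.φv Y) p - S.φ p (S.g.leviCivita X Y p)

end AlmostParacontactMetric

end Paracontact

end

namespace Paracontact

variable {E : Type*} [NormedAddCommGroup E] [NormedSpace ℝ E]
  {H : Type*} [TopologicalSpace H] {I : ModelWithCorners ℝ E H}
  {M : Type*} [TopologicalSpace M] [ChartedSpace H M]

/-! Both formulas rest on the fact that a three-dimensional space carries only one alternating
3-form up to scale (`IsAlternatingThreeForm.exists_eq_mul`).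

The form `η ∧ Φ` vanishes nowhere, so `dΦ` is a multiple of it, and this defines `f`. Locally `f` is
a quotient of smooth functions, `3/2 dΦ(ξ, U, V) / Φ(U, V)` (`exists_contMDiff_dΦ_eq`).

For fixed `X`, put `B(Y, Z) = g((∇_X φ)Y, Z)`. Metric compatibility makes `B` skew and hence
tensorial. Comparing `η ∧ B` with `η ∧ Φ` gives `B = cΦ` on `ker η`. Differentiating `φ² = Id - η ⊗
ξ` gives `B(φu, v) = B(u, φv)` there, whereas `Φ(φu, v) = -Φ(u, φv)`, so `B` vanishes on `ker η`.
Thus `B` is determined by `B(·, ξ)` (`g_nablaφ_eq`), which the Koszul formula computes in terms of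
`f`, `dη` and `h` (`g_nablaφ_ξ`). -/

/-! ### Alternating 3-forms in dimension three -/

/-- `T` is an alternating trilinear form. -/
structure IsAlternatingThreeForm {V : Type*} [AddCommGroup V] [Module ℝ V]
    (T : V → V → V → ℝ) : Prop where
  add_left : ∀ x x' y z, T (x + x') y z = T x y z + T x' y z
  smul_left : ∀ (c : ℝ) x y z, T (c • x) y z = c * T x y z
  cycle : ∀ x y z, T x y z = T y z x
  self_left : ∀ x z, T x x z = 0

namespace IsAlternatingThreeForm

variable {V : Type*} [AddCommGroup V] [Module ℝ V] {T W : V → V → V → ℝ}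

/-- The alternating map of an alternating trilinear form. -/
noncomputable def toAlternatingMap (hT : IsAlternatingThreeForm T) : V [⋀^Fin 3]→ₗ[ℝ] ℝ where
  toFun v := T (v 0) (v 1) (v 2)
  map_update_add' := by
    intro inst m i x y
    obtain rfl : inst = instDecidableEqFin 3 := Subsingleton.elim _ _
    fin_cases i
    · simp [hT.add_left]
    · simp [hT.cycle (m 0), hT.add_left]
    · simp [← hT.cycle _ (m 0), hT.add_left]
  map_update_smul' := by
    intro inst m i c x
    obtain rfl : inst = instDecidableEqFin 3 := Subsingleton.elim _ _
    fin_cases i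
    · simp [hT.smul_left]
    · simp [hT.cycle (m 0), hT.smul_left]
    · simp [← hT.cycle _ (m 0), hT.smul_left]
  map_eq_zero_of_eq' v i j h hij := by
    fin_cases i <;> fin_cases j <;> simp at h hij ⊢
    · simp [h, hT.self_left]
    · rw [← hT.cycle, h, hT.self_left]
    · simp [h, hT.self_left]
    · rw [hT.cycle, h, hT.self_left]
    · rw [← hT.cycle, h, hT.self_left]
    · rw [hT.cycle, h, hT.self_left]

/-- On a three-dimensional space, alternating trilinear forms are proportional to any nonzero
one. -/
theorem exists_eq_mul (hT : IsAlternatingThreeForm T) (hW : IsAlternatingThreeForm W)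
    (hV : finrank ℝ V = 3) (hne : ∃ x y z, W x y z ≠ 0) :
    ∃ c : ℝ, ∀ x y z, T x y z = c * W x y z := by
  have : FiniteDimensional ℝ V := FiniteDimensional.of_finrank_pos (by omega)
  let b : Basis (Fin 3) ℝ V := finBasisOfFinrankEq ℝ V hV
  have eT : ∀ x y z, T x y z = T (b 0) (b 1) (b 2) * b.det ![x, y, z] := fun x y z => by
    simpa [toAlternatingMap] using
      congrArg (fun f => f ![x, y, z]) (hT.toAlternatingMap.eq_smul_basis_det b)
  have eW : ∀ x y z, W x y z = W (b 0) (b 1) (b 2) * b.det ![x, y, z] := fun x y z => by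
    simpa [toAlternatingMap] using
      congrArg (fun f => f ![x, y, z]) (hW.toAlternatingMap.eq_smul_basis_det b)
  have h0 : W (b 0) (b 1) (b 2) ≠ 0 := by
    obtain ⟨x, y, z, h⟩ := hne
    rw [eW] at h
    exact left_ne_zero_of_mul h
  refine ⟨T (b 0) (b 1) (b 2) / W (b 0) (b 1) (b 2), fun x y z => ?_⟩
  rw [eT, eW x y z]
  field_simp

end IsAlternatingThreeForm

/-! ### Smoothness of derivatives and brackets -/

theorem _root_.ContMDiffAt.dirDeriv [IsManifold I ∞ M] {X : Π p : M, TangentSpace I p}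
    {u : M → ℝ} {p : M} (hX : ContMDiffAt I (I.prod 𝓘(ℝ, E)) ∞ (T% X) p)
    (hu : ContMDiffAt I 𝓘(ℝ, ℝ) ∞ u p) : ContMDiffAt I 𝓘(ℝ, ℝ) ∞ (dirDeriv I X u) p := by
  have : IsManifold I 1 M := IsManifold.of_le (n := ∞) (by simp)
  have h1 := hu.mfderiv_const (m := ∞) (by simp)
  have h2 := ContMDiffAt.clm_apply_of_inCoordinates (F₁ := E) (E₁ := TangentSpace I (M := M))
    (F₂ := ℝ) (E₂ := TangentSpace 𝓘(ℝ, ℝ) (M := ℝ)) (b₁ := id) (b₂ := u)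
    (ϕ := fun q => mfderiv I 𝓘(ℝ, ℝ) u q) (v := X) h1 hX hu
  rw [contMDiffAt_totalSpace] at h2
  have h3 : ContMDiffAt I 𝓘(ℝ, ℝ) ∞ (fun q => mfderiv I 𝓘(ℝ, ℝ) u q (X q) : M → ℝ) p := by
    simpa using h2.2
  exact h3

theorem _root_.ContMDiffAt.mlieBracket [IsManifold I ∞ M] [CompleteSpace E]
    {X Y : Π p : M, TangentSpace I p} {p : M}
    (hX : ContMDiffAt I (I.prod 𝓘(ℝ, E)) ∞ (T% X) p)
    (hY : ContMDiffAt I (I.prod 𝓘(ℝ, E)) ∞ (T% Y) p) :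
    ContMDiffAt I (I.prod 𝓘(ℝ, E)) ∞ (T% (mlieBracket I X Y)) p := by
  have : IsManifold I ((⊤ : ℕ∞) + 1) M := by simpa using ‹IsManifold I ∞ M›
  have : IsManifold I (minSmoothness ℝ 2) M := by
    simpa using (inferInstance : IsManifold I 2 M)
  exact ContMDiffAt.mlieBracket_vectorField (m := ⊤) (n := ⊤) hX hY (by simp)

/-! ### Pointwise algebra of the structure tensors -/

namespace AlmostParacontactMetric

variable [IsManifold I ∞ M] {n : ℕ} (S : AlmostParacontactMetric I M n)

/-- Since `φ²ξ = 0`, applying `φ² = Id - η ⊗ ξ` to `φξ` shows that `φξ` is a multiple of `ξ`.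
Applying `φ` once more squares the factor, which must therefore be zero. -/
theorem φ_ξ (p : M) : S.φ p (S.ξ p) = 0 := by
  have h1 : S.φ p (S.φ p (S.ξ p)) = 0 := by simp [S.φ_sq, S.η_ξ]
  have h2 : S.φ p (S.ξ p) = S.η p (S.φ p (S.ξ p)) • S.ξ p := by
    have := S.φ_sq p (S.φ p (S.ξ p))
    rw [h1, map_zero] at this
    exact sub_eq_zero.1 this.symm
  have h3 : S.η p (S.φ p (S.ξ p)) = 0 := by
    rw [h2, map_smul, h2, smul_smul] at h1
    simpa [S.η_ξ] using congrArg (S.η p) h1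
  rw [h2, h3, zero_smul]

theorem η_φ (p : M) (v : TangentSpace I p) : S.η p (S.φ p v) = 0 := by
  have h1 : S.φ p (S.φ p (S.φ p v)) = S.φ p v := by
    rw [S.φ_sq p v, map_sub, map_smul, S.φ_ξ, smul_zero, sub_zero]
  rw [S.φ_sq p (S.φ p v)] at h1
  simpa [S.η_ξ] using (congrArg (S.η p) h1).symm

theorem g_ξ (p : M) (v : TangentSpace I p) : S.g.toFun p v (S.ξ p) = S.η p v := by
  have := S.g_φ_φ p v (S.ξ p)
  rw [S.φ_ξ, map_zero, S.η_ξ] at this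
  linarith

theorem g_φ_left (p : M) (u v : TangentSpace I p) :
    S.g.toFun p (S.φ p u) v = - S.g.toFun p u (S.φ p v) := by
  have := S.g_φ_φ p u (S.φ p v)
  rw [S.φ_sq, S.η_φ, map_sub, map_smul, S.g_ξ, S.η_φ] at this
  simpa using this

theorem Φ_swap (p : M) (u v : TangentSpace I p) : S.Φ p u v = - S.Φ p v u := by
  rw [Φ, S.g.symm, S.g_φ_left, Φ]

@[simp] theorem Φ_ξ_right (p : M) (u : TangentSpace I p) : S.Φ p u (S.ξ p) = 0 := by
  simp [Φ, S.φ_ξ]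

@[simp] theorem Φ_ξ_left (p : M) (u : TangentSpace I p) : S.Φ p (S.ξ p) u = 0 := by
  rw [S.Φ_swap]; simp

@[simp] theorem Φ_self (p : M) (u : TangentSpace I p) : S.Φ p u u = 0 := by
  linarith [S.Φ_swap p u u]

@[simp] theorem Φ_add_left (p : M) (u v w : TangentSpace I p) :
    S.Φ p (u + v) w = S.Φ p u w + S.Φ p v w := by simp [Φ]

@[simp] theorem Φ_add_right (p : M) (u v w : TangentSpace I p) :
    S.Φ p u (v + w) = S.Φ p u v + S.Φ p u w := by simp [Φ]

@[simp] theorem Φ_smul_left (p : M) (c : ℝ) (u v : TangentSpace I p) :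
    S.Φ p (c • u) v = c * S.Φ p u v := by simp [Φ]

@[simp] theorem Φ_smul_right (p : M) (c : ℝ) (u v : TangentSpace I p) :
    S.Φ p u (c • v) = c * S.Φ p u v := by simp [Φ]

@[simp] theorem Φ_neg_left (p : M) (u v : TangentSpace I p) :
    S.Φ p (-u) v = - S.Φ p u v := by simp [Φ]

/-- Wedging with `η` turns a skew 2-form into a top form, which can then be compared with `η ∧ Φ`.
The factor `1/3` is dropped. -/
theorem isAlternatingThreeForm_wedge (p : M) {B : TangentSpace I p → TangentSpace I p → ℝ}
    (hadd : ∀ x y z, B (x + y) z = B x z + B y z) (hsmul : ∀ (c : ℝ) x y, B (c • x) y = c * B x y)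
    (hskew : ∀ x y, B x y = - B y x) :
    IsAlternatingThreeForm fun x y z => S.η p x * B y z + S.η p y * B z x + S.η p z * B x y where
  add_left x x' y z := by
    rw [hskew z, hadd, hadd, hskew z x, hskew z x', map_add]; ring
  smul_left c x y z := by
    rw [hskew z, hsmul, hsmul, hskew z x, map_smul, smul_eq_mul]; ring
  cycle x y z := by ring
  self_left x z := by
    have h0 : B x x = 0 := by linarith [hskew x x]
    rw [hskew z x, h0]; ring

theorem isAlternatingThreeForm_ηΦ (p : M) :
    IsAlternatingThreeForm fun x y z =>
      S.η p x * S.Φ p y z + S.η p y * S.Φ p z x + S.η p z * S.Φ p x y :=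
  S.isAlternatingThreeForm_wedge p (S.Φ_add_left p) (S.Φ_smul_left p) (S.Φ_swap p)

/-- If `Φ` vanished at `p`, nondegeneracy would force `φ = 0` there. Then `φ² = Id - η ⊗ ξ` would
make `ξ` span the tangent space. -/
theorem exists_Φ_ne_zero (hE : finrank ℝ E = 3) (p : M) : ∃ u v, S.Φ p u v ≠ 0 := by
  by_contra! h
  have hφ : ∀ v, S.φ p v = 0 := fun v => S.g.nondegenerate p _ fun w => by
    rw [S.g.symm]; exact h w v
  have hξ : ∀ v : TangentSpace I p, ∃ c : ℝ, c • S.ξ p = v := fun v =>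
    ⟨S.η p v, (sub_eq_zero.1 (by rw [← S.φ_sq, hφ])).symm⟩
  have := finrank_le_one (S.ξ p) hξ
  have : finrank ℝ (TangentSpace I p) = 3 := hE
  omega

/-! ### Regularity of the structure tensors on vector fields -/

theorem mdifferentiable_ξ (p : M) : MDiffAt (T% S.ξ) p :=
  (S.smooth_ξ p).mdifferentiableAt (by simp)

theorem contMDiffAt_φv {Y : Π p : M, TangentSpace I p} {p : M}
    (hY : ContMDiffAt I (I.prod 𝓘(ℝ, E)) ∞ (T% Y) p) :
    ContMDiffAt I (I.prod 𝓘(ℝ, E)) ∞ (T% (S.φv Y)) p :=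
  ContMDiffAt.clm_bundle_apply (F₁ := E) (F₂ := E) (S.smooth_φ p) hY

theorem mdifferentiableAt_φv {Y : Π p : M, TangentSpace I p} {p : M} (hY : MDiffAt (T% Y) p) :
    MDiffAt (T% (S.φv Y)) p :=
  MDifferentiableAt.clm_bundle_apply (F₁ := E) (F₂ := E)
    ((S.smooth_φ p).mdifferentiableAt (by simp)) hY

theorem contMDiffAt_Φ {X Y : Π p : M, TangentSpace I p} {p : M}
    (hX : ContMDiffAt I (I.prod 𝓘(ℝ, E)) ∞ (T% X) p)
    (hY : ContMDiffAt I (I.prod 𝓘(ℝ, E)) ∞ (T% Y) p) :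
    ContMDiffAt I 𝓘(ℝ, ℝ) ∞ (fun q => S.Φ q (X q) (Y q)) p := by
  have : ContMDiffAt I (I.prod 𝓘(ℝ)) ∞ (fun q : M => TotalSpace.mk' ℝ (E := Bundle.Trivial M ℝ) q
      (S.g.toFun q (X q) (S.φv Y q))) p :=
    ContMDiffAt.clm_bundle_apply₂ (F₁ := E) (F₂ := E) (S.g.smooth p) hX (S.contMDiffAt_φv hY)
  rw [contMDiffAt_totalSpace] at this
  exact this.2

theorem mdifferentiableAt_Φ {X Y : Π p : M, TangentSpace I p} {p : M}
    (hX : MDiffAt (T% X) p) (hY : MDiffAt (T% Y) p) :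
    MDiffAt (fun q => S.Φ q (X q) (Y q)) p :=
  S.g.mdifferentiableAt_apply hX (S.mdifferentiableAt_φv hY)

theorem mdifferentiableAt_η {X : Π p : M, TangentSpace I p} {p : M}
    (hX : MDiffAt (T% X) p) : MDiffAt (fun q => S.η q (X q)) p := by
  simpa only [S.g_ξ] using S.g.mdifferentiableAt_apply hX (S.mdifferentiable_ξ p)

theorem contMDiffAt_dΦ [CompleteSpace E] {X Y Z : Π p : M, TangentSpace I p} {p : M}
    (hX : ContMDiffAt I (I.prod 𝓘(ℝ, E)) ∞ (T% X) p)
    (hY : ContMDiffAt I (I.prod 𝓘(ℝ, E)) ∞ (T% Y) p)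
    (hZ : ContMDiffAt I (I.prod 𝓘(ℝ, E)) ∞ (T% Z) p) :
    ContMDiffAt I 𝓘(ℝ, ℝ) ∞ (S.dΦ X Y Z) p := by
  unfold dΦ dTwo
  exact contMDiffAt_const.mul ((((((hX.dirDeriv (S.contMDiffAt_Φ hY hZ)).add
    (hY.dirDeriv (S.contMDiffAt_Φ hZ hX))).add
    (hZ.dirDeriv (S.contMDiffAt_Φ hX hY))).sub
    (S.contMDiffAt_Φ (hX.mlieBracket hY) hZ)).sub
    (S.contMDiffAt_Φ (hY.mlieBracket hZ) hX)).sub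
    (S.contMDiffAt_Φ (hZ.mlieBracket hX) hY))

/-! ### `dΦ` as a multiple of `η ∧ Φ` -/

/-- Only the first slot is needed; cyclic symmetry transfers tensoriality to the other two. -/
theorem dΦ_tensorialAt [CompleteSpace E] {Y Z : Π p : M, TangentSpace I p} {p : M}
    (hY : MDiffAt (T% Y) p) (hZ : MDiffAt (T% Z) p) :
    TensorialAt I E (fun X : Π p : M, TangentSpace I p => S.dΦ X Y Z p) p where
  smul {f X} hf hX := by
    have e1 := mvfderiv_mul hf (S.mdifferentiableAt_Φ hZ hX)
    have e2 := mvfderiv_mul hf (S.mdifferentiableAt_Φ hX hY)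
    have r1 : (fun q => S.Φ q (Z q) ((f • X) q)) = f * fun q => S.Φ q (Z q) (X q) := by
      ext q; simp
    have r2 : (fun q => S.Φ q ((f • X) q) (Y q)) = f * fun q => S.Φ q (X q) (Y q) := by
      ext q; simp
    simp only [dΦ, dTwo, dirDeriv, r1, r2, e1, e2, mlieBracket_smul_left hf hX,
      mlieBracket_smul_right hf hX]
    simp [S.Φ_swap p (Z p) (X p)]
    ring
  add {X X'} hX hX' := by
    have e1 := mvfderiv_add (S.mdifferentiableAt_Φ hZ hX) (S.mdifferentiableAt_Φ hZ hX')
    have e2 := mvfderiv_add (S.mdifferentiableAt_Φ hX hY) (S.mdifferentiableAt_Φ hX' hY)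
    have r1 : (fun q => S.Φ q (Z q) ((X + X') q)) =
        (fun q => S.Φ q (Z q) (X q)) + fun q => S.Φ q (Z q) (X' q) := by
      ext q; simp
    have r2 : (fun q => S.Φ q ((X + X') q) (Y q)) =
        (fun q => S.Φ q (X q) (Y q)) + fun q => S.Φ q (X' q) (Y q) := by
      ext q; simp
    simp only [dΦ, dTwo, dirDeriv, r1, r2, e1, e2, mlieBracket_add_left hX hX',
      mlieBracket_add_right hX hX']
    simp
    ring

theorem dΦ_cycle (X Y Z : Π p : M, TangentSpace I p) (p : M) : S.dΦ X Y Z p = S.dΦ Y Z X p := by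
  simp only [dΦ, dTwo]; ring

theorem dΦ_self_left (X Z : Π p : M, TangentSpace I p) (p : M) : S.dΦ X X Z p = 0 := by
  have r : (fun q => S.Φ q (Z q) (X q)) = - fun q => S.Φ q (X q) (Z q) := by
    ext q; exact S.Φ_swap q _ _
  have r0 : (fun q => S.Φ q (X q) (X q)) = 0 := by
    ext q; simp
  simp only [dΦ, dTwo, dirDeriv, r, r0, mvfderiv_neg, mvfderiv_zero, mlieBracket_self]
  rw [mlieBracket_swap_apply (V := Z)]
  simp [Φ]

theorem dΦ_congr [FiniteDimensional ℝ E] {X Y Z X' Y' Z' : Π p : M, TangentSpace I p} {p : M}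
    (hX : MDiffAt (T% X) p) (hY : MDiffAt (T% Y) p) (hZ : MDiffAt (T% Z) p)
    (hX' : MDiffAt (T% X') p) (hY' : MDiffAt (T% Y') p) (hZ' : MDiffAt (T% Z') p)
    (eX : X p = X' p) (eY : Y p = Y' p) (eZ : Z p = Z' p) :
    S.dΦ X Y Z p = S.dΦ X' Y' Z' p := by
  have : CompleteSpace E := FiniteDimensional.complete ℝ E
  rw [(S.dΦ_tensorialAt hY hZ).pointwise hX hX' eX, S.dΦ_cycle,
    (S.dΦ_tensorialAt hZ hX').pointwise hY hY' eY, S.dΦ_cycle,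
    (S.dΦ_tensorialAt hX' hY').pointwise hZ hZ' eZ, S.dΦ_cycle]

theorem exists_dΦ_eq [FiniteDimensional ℝ E] (hE : finrank ℝ E = 3) (p : M) :
    ∃ c : ℝ, ∀ X Y Z : Π p : M, TangentSpace I p,
      MDiffAt (T% X) p → MDiffAt (T% Y) p → MDiffAt (T% Z) p →
      S.dΦ X Y Z p = 2 * c * S.ηΦ X Y Z p := by
  have : CompleteSpace E := FiniteDimensional.complete ℝ E
  let e : TangentSpace I p → Π q : M, TangentSpace I q := FiberBundle.extend E
  have he : ∀ u, MDiffAt (T% (e u)) p := fun u => FiberBundle.mdifferentiableAt_extend ..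
  have hep : ∀ u, e u p = u := fun u => FiberBundle.extend_apply_self ..
  have hT : IsAlternatingThreeForm fun x y z => S.dΦ (e x) (e y) (e z) p :=
    { add_left := fun x x' y z => by
        have h := S.dΦ_tensorialAt (he y) (he z)
        rw [← h.add (he x) (he x')]
        exact h.pointwise (he _) (mdifferentiableAt_add_section (he x) (he x')) (by simp [hep])
      smul_left := fun c x y z => by
        have h := S.dΦ_tensorialAt (he y) (he z)
        have hc : MDiffAt (fun _ : M => c) p := mdifferentiableAt_const
        have := h.smul hc (he x)
        rw [smul_eq_mul] at this
        rw [← this]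
        exact h.pointwise (he _) (hc.smul_section (he x)) (by simp [hep])
      cycle := fun x y z => S.dΦ_cycle ..
      self_left := fun x z => S.dΦ_self_left .. }
  obtain ⟨u, v, huv⟩ := S.exists_Φ_ne_zero hE p
  obtain ⟨c, hc⟩ := hT.exists_eq_mul (S.isAlternatingThreeForm_ηΦ p) hE
    ⟨S.ξ p, u, v, by simpa [S.η_ξ] using huv⟩
  -- `c` compares `dΦ` with the wedge without its `1/3`, and the statement has a factor `2`.
  refine ⟨3 / 2 * c, fun X Y Z hX hY hZ => ?_⟩
  rw [S.dΦ_congr hX hY hZ (he (X p)) (he (Y p)) (he (Z p)) (hep _).symm (hep _).symm (hep _).symm,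
    hc, ηΦ, wedgeOneTwo]
  ring

theorem exists_contMDiff_dΦ_eq [FiniteDimensional ℝ E] (hE : finrank ℝ E = 3) :
    ∃ f : M → ℝ, ContMDiff I 𝓘(ℝ, ℝ) ∞ f ∧ ∀ (p : M) (X Y Z : Π p : M, TangentSpace I p),
      MDiffAt (T% X) p → MDiffAt (T% Y) p → MDiffAt (T% Z) p →
      S.dΦ X Y Z p = 2 * f p * S.ηΦ X Y Z p := by
  have : CompleteSpace E := FiniteDimensional.complete ℝ E
  have : IsManifold I 1 M := IsManifold.of_le (n := ∞) (by simp)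
  choose f hf using S.exists_dΦ_eq hE
  refine ⟨f, fun p => ?_, hf⟩
  obtain ⟨u, v, huv⟩ := S.exists_Φ_ne_zero hE p
  let U : Π q : M, TangentSpace I q := FiberBundle.extend E u
  let V : Π q : M, TangentSpace I q := FiberBundle.extend E v
  have hU : ContMDiffAt I (I.prod 𝓘(ℝ, E)) ∞ (T% U) p := FiberBundle.contMDiffAt_extend ..
  have hV : ContMDiffAt I (I.prod 𝓘(ℝ, E)) ∞ (T% V) p := FiberBundle.contMDiffAt_extend ..
  have hUV := S.contMDiffAt_Φ hU hV
  have hne : S.Φ p (U p) (V p) ≠ 0 := by simpa [U, V] using huv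
  have h1 := (contMDiffAt_const (c := (3 / 2 : ℝ))).mul
    ((S.contMDiffAt_dΦ (S.smooth_ξ p) hU hV).div₀ hUV hne)
  refine h1.congr_of_eventuallyEq ?_
  -- Smoothness of order `∞` at a point need not spread to a neighbourhood. Order `1` does, and
  -- suffices to apply `hf` at nearby points.
  filter_upwards [(contMDiffAt_iff_contMDiffAt_nhds (n := 1) (by simp)).1 (ContMDiffAt.of_le hU (by simp)),
    (contMDiffAt_iff_contMDiffAt_nhds (n := 1) (by simp)).1 (ContMDiffAt.of_le hV (by simp)),
    hUV.continuousAt.eventually_ne hne] with q hUq hVq hq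
  have := hf q S.ξ U V (S.mdifferentiable_ξ q) (ContMDiffAt.mdifferentiableAt hUq (by simp))
    (ContMDiffAt.mdifferentiableAt hVq (by simp))
  simp only [ηΦ, wedgeOneTwo, S.η_ξ, Φ_ξ_left, Φ_ξ_right] at this
  simp only [Pi.mul_apply, Pi.div_apply, this]
  field_simp
  ring

end AlmostParacontactMetric

/-! ### The Levi-Civita connection and `∇φ` -/

variable [IsManifold I ∞ M]

/-- The Levi-Civita connection is compatible with the metric. -/
theorem PseudoMetric.dirDeriv_apply [FiniteDimensional ℝ E] {r s : ℕ} (g : PseudoMetric I M r s)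
    {X Y Z : Π p : M, TangentSpace I p} {p : M}
    (hX : MDiffAt (T% X) p) (hY : MDiffAt (T% Y) p) (hZ : MDiffAt (T% Z) p) :
    dirDeriv I X (fun q => g.toFun q (Y q) (Z q)) p =
      g.toFun p (g.leviCivita X Y p) (Z p) + g.toFun p (Y p) (g.leviCivita X Z p) := by
  have h1 := g.two_mul_leviCivita hX hY hZ
  have h2 := g.two_mul_leviCivita hX hZ hY
  have hs : ∀ A B : Π p : M, TangentSpace I p,
      (fun q => g.toFun q (A q) (B q)) = fun q => g.toFun q (B q) (A q) :=
    fun A B => funext fun q => g.symm q _ _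
  simp only [koszul, hs Z X, hs Z Y, hs Y X, mlieBracket_swap_apply (V := Z),
    mlieBracket_swap_apply (V := Y) (W := X), map_neg, neg_apply] at h1 h2
  rw [g.symm p (Y p)]
  linarith

namespace AlmostParacontactMetric

variable {n : ℕ} (S : AlmostParacontactMetric I M n) [FiniteDimensional ℝ E]
  {X Y Z : Π p : M, TangentSpace I p} {p : M}

theorem g_nablaφ (X Y : Π p : M, TangentSpace I p) (v : TangentSpace I p) :
    S.g.toFun p (S.nablaφ X Y p) v =
      S.g.toFun p (S.g.leviCivita X (S.φv Y) p) v + S.g.toFun p (S.g.leviCivita X Y p) (S.φ p v) := by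
  rw [nablaφ, map_sub, sub_apply, S.g_φ_left, sub_neg_eq_add]

/-- This is the derivative along `X` of `g(φY, Z) = -g(Y, φZ)`. -/
theorem g_nablaφ_swap
    (hX : MDiffAt (T% X) p) (hY : MDiffAt (T% Y) p) (hZ : MDiffAt (T% Z) p) :
    S.g.toFun p (S.nablaφ X Y p) (Z p) = - S.g.toFun p (S.nablaφ X Z p) (Y p) := by
  have h1 := S.g.dirDeriv_apply hX (S.mdifferentiableAt_φv hY) hZ
  have h2 := S.g.dirDeriv_apply hX hY (S.mdifferentiableAt_φv hZ)
  have r : (fun q => S.g.toFun q (S.φv Y q) (Z q)) = - fun q => S.g.toFun q (Y q) (S.φv Z q) :=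
    funext fun q => S.g_φ_left q _ _
  rw [r, dirDeriv, mvfderiv_neg] at h1
  rw [dirDeriv] at h2
  rw [neg_apply, h2] at h1
  rw [S.g_nablaφ, S.g_nablaφ, S.g.symm p _ (Y p), S.g.symm p _ (S.φ p (Y p))]
  simp only [φv] at h1
  linarith

/-- This differentiates `g(φ²Y, Z) = g(Y, Z) - η(Y)η(Z)`. The vanishing of `η(Y)` and `η(Z)` at `p`
alone kills the derivative of the product. -/
theorem g_nablaφ_φv
    (hX : MDiffAt (T% X) p) (hY : MDiffAt (T% Y) p) (hZ : MDiffAt (T% Z) p)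
    (hηY : S.η p (Y p) = 0) (hηZ : S.η p (Z p) = 0) :
    S.g.toFun p (S.nablaφ X (S.φv Y) p) (Z p) =
      S.g.toFun p (S.nablaφ X Y p) (S.φ p (Z p)) := by
  have h1 := S.g.dirDeriv_apply hX (S.mdifferentiableAt_φv (S.mdifferentiableAt_φv hY)) hZ
  have h2 := S.g.dirDeriv_apply hX hY hZ
  have e1 := mvfderiv_sub (S.g.mdifferentiableAt_apply hY hZ)
    ((S.mdifferentiableAt_η hY).mul (S.mdifferentiableAt_η hZ))
  have e2 := mvfderiv_mul (S.mdifferentiableAt_η hY) (S.mdifferentiableAt_η hZ)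
  have r : (fun q => S.g.toFun q (S.φv (S.φv Y) q) (Z q)) =
      (fun q => S.g.toFun q (Y q) (Z q)) -
        (fun q => S.η q (Y q)) * fun q => S.η q (Z q) := by
    ext q
    simp [φv, S.φ_sq, S.g.symm q (S.ξ q), S.g_ξ]
  have rp : S.φv (S.φv Y) p = Y p := by simp [φv, S.φ_sq, hηY]
  rw [r, dirDeriv, e1, e2, rp, hηY, hηZ, zero_smul, zero_smul, add_zero, sub_zero] at h1
  rw [dirDeriv] at h2
  rw [S.g_nablaφ, S.g_nablaφ, S.φ_sq, hηZ, zero_smul, sub_zero]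
  linarith

/-- Skew-symmetry moves `Y` into the second slot, where only its value at `p` enters. -/
theorem g_nablaφ_congr
    (hX : MDiffAt (T% X) p) (hY : MDiffAt (T% Y) p) (hZ : MDiffAt (T% Z) p) (h : Y p = Z p)
    (v : TangentSpace I p) :
    S.g.toFun p (S.nablaφ X Y p) v = S.g.toFun p (S.nablaφ X Z p) v := by
  have hv : MDiffAt (T% (FiberBundle.extend E v : Π q : M, TangentSpace I q)) p :=
    FiberBundle.mdifferentiableAt_extend ..
  have h1 := S.g_nablaφ_swap hX hY hv
  have h2 := S.g_nablaφ_swap hX hZ hv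
  rw [FiberBundle.extend_apply_self] at h1 h2
  rw [h1, h2, h]

theorem g_nablaφ_eq (hE : finrank ℝ E = 3)
    (hX : MDiffAt (T% X) p) (hY : MDiffAt (T% Y) p) (hZ : MDiffAt (T% Z) p) :
    S.g.toFun p (S.nablaφ X Y p) (Z p) =
      S.g.toFun p (S.nablaφ X Y p) (S.ξ p) * S.η p (Z p)
        - S.g.toFun p (S.nablaφ X Z p) (S.ξ p) * S.η p (Y p) := by
  let e : TangentSpace I p → Π q : M, TangentSpace I q := FiberBundle.extend E
  have he : ∀ u, MDiffAt (T% (e u)) p := fun u => FiberBundle.mdifferentiableAt_extend ..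
  have hep : ∀ u, e u p = u := fun u => FiberBundle.extend_apply_self ..
  let B : TangentSpace I p → TangentSpace I p → ℝ := fun u v =>
    S.g.toFun p (S.nablaφ X (e u) p) v
  have hB : ∀ {V : Π q : M, TangentSpace I q} (_ : MDiffAt (T% V) p) (v : TangentSpace I p),
      S.g.toFun p (S.nablaφ X V p) v = B (V p) v := fun hV v =>
    S.g_nablaφ_congr hX hV (he _) (hep _).symm v
  have hskew : ∀ u v, B u v = - B v u := fun u v => by
    simpa only [hep] using S.g_nablaφ_swap hX (he u) (he v)
  have hadd' : ∀ u v w, B w (u + v) = B w u + B w v := fun u v w => by simp [B]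
  have hsmul' : ∀ (c : ℝ) u v, B v (c • u) = c * B v u := fun c u v => by simp [B]
  have hadd : ∀ u v w, B (u + v) w = B u w + B v w := fun u v w => by
    rw [hskew, hadd', hskew u, hskew v]; ring
  have hsmul : ∀ (c : ℝ) u v, B (c • u) v = c * B u v := fun c u v => by
    rw [hskew, hsmul', hskew u]; ring
  have hφ : ∀ u v, S.η p u = 0 → S.η p v = 0 → B (S.φ p u) v = B u (S.φ p v) := by
    intro u v hu hv
    have := S.g_nablaφ_φv hX (he u) (he v) (by rw [hep, hu]) (by rw [hep, hv])
    rw [hB (S.mdifferentiableAt_φv (he u)), φv, hep, hep] at this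
    exact this
  obtain ⟨u, v, huv⟩ := S.exists_Φ_ne_zero hE p
  obtain ⟨c, hc⟩ := (S.isAlternatingThreeForm_wedge p hadd hsmul hskew).exists_eq_mul
    (S.isAlternatingThreeForm_ηΦ p) hE ⟨S.ξ p, u, v, by simpa [S.η_ξ] using huv⟩
  have hBΦ : ∀ u v, S.η p u = 0 → S.η p v = 0 → B u v = c * S.Φ p u v := by
    intro u v hu hv
    simpa [S.η_ξ, hu, hv] using hc (S.ξ p) u v
  -- With `B = cΦ`, the two sides of `hφ` are `-c g(u, v)` and `c g(u, v)`.
  have hcg : ∀ u v, S.η p u = 0 → S.η p v = 0 → c * S.g.toFun p u v = 0 := by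
    intro u v hu hv
    have := hφ u v hu hv
    rw [hBΦ _ _ (S.η_φ p u) hv, hBΦ _ _ hu (S.η_φ p v), Φ, Φ, S.g_φ_φ, S.φ_sq, hu, hv] at this
    simp at this
    linarith
  have hB0 : ∀ u v, S.η p u = 0 → S.η p v = 0 → B u v = 0 := fun u v hu hv => by
    rw [hBΦ u v hu hv, Φ, hcg u _ hu (S.η_φ p v)]
  rw [hB hY, hB hY, hB hZ]
  -- The vanishing on `ker η` is applied to the projections of `Y` and `Z` along `ξ`, then expanded.
  have hproj : ∀ w, S.η p (w + (-S.η p w) • S.ξ p) = 0 := fun w => by simp [S.η_ξ]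
  have hξξ : B (S.ξ p) (S.ξ p) = 0 := by linarith [hskew (S.ξ p) (S.ξ p)]
  have := hB0 _ _ (hproj (Y p)) (hproj (Z p))
  rw [hadd, hadd', hadd', hsmul, hsmul', hsmul', hsmul, hξξ, hskew (S.ξ p) (Z p)] at this
  linarith

/-- Because `φξ = 0`, the left side is `g(∇_X(φY), ξ)`. After the terms of `dη(φY, X)` and `g(hY,
X)` are removed from its Koszul expansion, what remains is a multiple of `dΦ(ξ, X, Y)`, which `hc`
evaluates. -/
theorem g_nablaφ_ξ {c : ℝ} (hX : MDiffAt (T% X) p) (hY : MDiffAt (T% Y) p)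
    (hc : S.dΦ S.ξ X Y p = 2 * c * S.ηΦ S.ξ X Y p) :
    S.g.toFun p (S.nablaφ X Y p) (S.ξ p) =
      c * S.Φ p (Y p) (X p) + S.dη (S.φv Y) X p + S.g.toFun p (S.h Y p) (X p) := by
  have h1 := S.g.two_mul_leviCivita hX (S.mdifferentiableAt_φv hY) (S.mdifferentiable_ξ p)
  have r2 : (fun q => S.g.toFun q (S.ξ q) (X q)) = fun q => S.η q (X q) := by
    ext q; rw [S.g.symm, S.g_ξ]
  have r3 : (fun q => S.η q (S.φv Y q)) = 0 := by
    ext q; exact S.η_φ q _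
  have r4 : (fun q => S.g.toFun q (X q) (S.φv Y q)) = fun q => S.Φ q (X q) (Y q) := rfl
  have r7 : (fun q => S.φ q (Y q)) = S.φv Y := rfl
  rw [S.g_nablaφ, S.φ_ξ, map_zero, add_zero, S.g_ξ]
  simp only [PseudoMetric.koszul, r2, r4, dirDeriv, S.g_ξ, r3, mvfderiv_zero] at h1
  simp only [dΦ, dTwo, ηΦ, wedgeOneTwo, dirDeriv, mvfderiv_const, Φ_ξ_left, Φ_ξ_right,
    S.η_ξ, mlieBracket_swap_apply (V := Y) (W := S.ξ), Φ_neg_left] at hc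
  simp only [dη, dOne, r3, dirDeriv, mvfderiv_zero, h, lieDerivEnd, r7]
  rw [mlieBracket_swap_apply (V := S.φv Y) (W := S.ξ)] at h1
  rw [mlieBracket_swap_apply (V := S.φv Y) (W := X)]
  rw [S.Φ_swap p (Y p) (X p)]
  have e1 : S.g.toFun p (mlieBracket I S.ξ X p) (S.φv Y p) = S.Φ p (mlieBracket I S.ξ X p) (Y p) :=
    rfl
  have e2 := S.g_φ_left p (mlieBracket I S.ξ Y p) (X p)
  change _ = - S.Φ p (mlieBracket I S.ξ Y p) (X p) at e2
  simp only [map_smul, map_sub, map_neg, neg_apply, zero_apply, smul_apply, sub_apply, smul_eq_mul,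
    e1, e2] at h1 hc ⊢
  linarith

end AlmostParacontactMetric
end Paracontact

theorem mainTheorem9
    {E : Type*} [NormedAddCommGroup E] [NormedSpace ℝ E] [FiniteDimensional ℝ E]
    (hdim : Module.finrank ℝ E = 3)
    {H : Type*} [TopologicalSpace H] (I : ModelWithCorners ℝ E H)
    {M : Type*} [TopologicalSpace M] [ChartedSpace H M] [IsManifold I ∞ M]
    [BoundarylessManifold I M]
    (S : Paracontact.AlmostParacontactMetric I M 1) :
    ∃ f : M → ℝ, ContMDiff I 𝓘(ℝ, ℝ) ∞ f ∧
      ∀ (p : M) (X Y Z : Π q : M, TangentSpace I q),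
        ContMDiffAt I (I.prod 𝓘(ℝ, E)) ∞ (fun q => TotalSpace.mk' E q (X q)) p →
        ContMDiffAt I (I.prod 𝓘(ℝ, E)) ∞ (fun q => TotalSpace.mk' E q (Y q)) p →
        ContMDiffAt I (I.prod 𝓘(ℝ, E)) ∞ (fun q => TotalSpace.mk' E q (Z q)) p →
        S.g.toFun p (S.nablaφ X Y p) (Z p) =
            (f p * S.Φ p (Y p) (X p) + S.dη (S.φv Y) X p + S.g.toFun p (S.h Y p) (X p))
              * S.η p (Z p)
            - (f p * S.Φ p (Z p) (X p) + S.dη (S.φv Z) X p + S.g.toFun p (S.h Z p) (X p))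
              * S.η p (Y p)
        ∧ S.dΦ X Y Z p = 2 * f p * S.ηΦ X Y Z p := by
  obtain ⟨f, hf, hfΦ⟩ := S.exists_contMDiff_dΦ_eq hdim
  refine ⟨f, hf, fun p X Y Z hX hY hZ => ?_⟩
  have hX' := hX.mdifferentiableAt (by simp)
  have hY' := hY.mdifferentiableAt (by simp)
  have hZ' := hZ.mdifferentiableAt (by simp)
  have hξ := S.mdifferentiable_ξ p
  refine ⟨?_, hfΦ p X Y Z hX' hY' hZ'⟩
  rw [S.g_nablaφ_eq hdim hX' hY' hZ', S.g_nablaφ_ξ hX' hY' (hfΦ p S.ξ X Y hξ hX' hY'),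
    S.g_nablaφ_ξ hX' hZ' (hfΦ p S.ξ X Z hξ hX' hZ')]
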